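/- **Theorem (Pointwise estimate).** Let $n \ge 2$. There exists a constant $C = C(n) \in (0,\infty)$, depending only on $n$, such that for every open set $\Omega \subset \mathbb{R}^n$ (no boundedness or regularity is assumed) and every vector field $u \in E^{1,1}(\Omega) \cap C_b(\overline\Omega)$, $$|u(x)| \le C \int_{\mathbb{S}^{n-1}} |u(\zeta(x,\vartheta))| \, d\mathcal{H}^{n-1}(\vartheta) + C \int_\Omega \frac{|\mathcal{E}u(y)|}{|x-y|^{n-1}} \, dy \qquad \text{for every } x \in \Omega,$$ where the right-hand side may be $+\infty$. Here: - $\mathcal{E}u = \tfrac12\big(\nabla u + (\nabla u)^T\big)$ is the symmetric part of the distributional gradient of $u$, and $|\mathcal E u|$ is its Euclidean (Frobenius) norm; - $E^{1,1}(\Omega)$ is the space of the vector fields $u : \Omega \to \mathbb{R}^n$ in $L^1_{\rm loc}(\Omega)$ such that $\mathcal{E}u$ is a function with $|\mathcal{E}u| \in L^1(\Omega)$; - $C_b(\overline\Omega)$ is the space of the vector fields $u : \overline\Omega \to \mathbb{R}^n$ that are continuous in $\overline\Omega$ and have bounded support; - $\mathbb{S}^{n-1}$ is the unit sphere in $\mathbb{R}^n$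 and $\mathcal{H}^{n-1}$ is the $(n-1)$-dimensional Hausdorff measure; - for $x \in \Omega$ and $\vartheta \in \mathbb{S}^{n-1}$ such that $x + t\vartheta \in \partial\Omega$ for some $t > 0$, $\zeta(x,\vartheta)$ is the first point of $\partial\Omega$ on the ray $\{x + t\vartheta : t > 0\}$; if the ray does not meet $\partial\Omega$, then $u(\zeta(x,\vartheta))$ is taken to be $0$. -/

import Mathlib

open MeasureTheory Set
open scoped ContDiff ENNReal NNReal

/-- `G` is (a representative of) the distributional symmetric gradient
`(∇u + (∇u)ᵀ) / 2` of the vector field `u` in the open set `Ω`, and it is a locally integrable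
function: for all indices `i, j` and every smooth real-valued `φ` with compact support in `Ω`,
`∫_Ω (u_i ∂_j φ + u_j ∂_i φ) / 2 = - ∫_Ω G_ij φ`.
Matrices are families of `n × n` entries with the Euclidean (Frobenius) norm. -/
def HasWeakSymGradient {n : ℕ} (Ω : Set (EuclideanSpace ℝ (Fin n)))
    (u : EuclideanSpace ℝ (Fin n) → EuclideanSpace ℝ (Fin n))
    (G : EuclideanSpace ℝ (Fin n) → EuclideanSpace ℝ (Fin n × Fin n)) : Prop :=
  LocallyIntegrableOn u Ω ∧ LocallyIntegrableOn G Ω ∧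
    ∀ i j : Fin n, ∀ φ : EuclideanSpace ℝ (Fin n) → ℝ,
      ContDiff ℝ ∞ φ → HasCompactSupport φ → tsupport φ ⊆ Ω →
        ∫ y in Ω, (u y i * fderiv ℝ φ y (EuclideanSpace.single j 1)
            + u y j * fderiv ℝ φ y (EuclideanSpace.single i 1)) / 2
          = - ∫ y in Ω, G y (i, j) * φ y

/-- The space `E^{1,p}(Ω)` of the vector fields in `L¹_loc(Ω)` whose distributional symmetric
gradient belongs to `L^p(Ω)`. -/
def MemE {n : ℕ} (p : ℝ≥0∞) (Ω : Set (EuclideanSpace ℝ (Fin n)))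
    (u : EuclideanSpace ℝ (Fin n) → EuclideanSpace ℝ (Fin n)) : Prop :=
  ∃ G, HasWeakSymGradient Ω u G ∧ MemLp G p (volume.restrict Ω)

/-- The space `C_b(Ω̄)` of the vector fields that are continuous in the closure of `Ω` and have
bounded support there. (Values outside the closure are irrelevant.) -/
def MemCb {n : ℕ} (Ω : Set (EuclideanSpace ℝ (Fin n)))
    (u : EuclideanSpace ℝ (Fin n) → EuclideanSpace ℝ (Fin n)) : Prop :=
  ContinuousOn u (closure Ω) ∧ Bornology.IsBounded (closure Ω ∩ Function.support u)

/-- The times `t > 0` at which the ray issued from `x` in the direction `θ` is on `∂Ω`. -/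
def hitTimes {n : ℕ} (Ω : Set (EuclideanSpace ℝ (Fin n))) (x θ : EuclideanSpace ℝ (Fin n)) :
    Set ℝ :=
  {t | 0 < t ∧ x + t • θ ∈ frontier Ω}

/-- The first point `ζ(x, θ)` of `∂Ω` on the ray issued from `x` in the direction `θ`
(meaningful when the ray meets `∂Ω`). -/
noncomputable def firstHit {n : ℕ} (Ω : Set (EuclideanSpace ℝ (Fin n)))
    (x θ : EuclideanSpace ℝ (Fin n)) : EuclideanSpace ℝ (Fin n) :=
  x + sInf (hitTimes Ω x θ) • θ

open Classical in
/-- The value `g(ζ(x, θ))`, with the convention that it is `0` if the ray issued from `x` in the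
direction `θ` does not meet `∂Ω`. -/
noncomputable def boundaryValue {n : ℕ} (Ω : Set (EuclideanSpace ℝ (Fin n)))
    (g : EuclideanSpace ℝ (Fin n) → EuclideanSpace ℝ (Fin n))
    (x θ : EuclideanSpace ℝ (Fin n)) : EuclideanSpace ℝ (Fin n) :=
  if (hitTimes Ω x θ).Nonempty then g (firstHit Ω x θ) else 0

/-- If the ray meets `∂Ω`, then its first hitting time is positive, `ζ(x, θ)` is in `∂Ω`, and
the points of the ray strictly between `x` and `ζ(x, θ)` are in `Ω`. -/
theorem firstHit_spec {n : ℕ} {Ω : Set (EuclideanSpace ℝ (Fin n))} (hΩ : IsOpen Ω)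
    {x θ : EuclideanSpace ℝ (Fin n)} (hx : x ∈ Ω) (h : (hitTimes Ω x θ).Nonempty) :
    0 < sInf (hitTimes Ω x θ) ∧ firstHit Ω x θ ∈ frontier Ω ∧
      ∀ t ∈ Ioo 0 (sInf (hitTimes Ω x θ)), x + t • θ ∈ Ω := by
  have hc : Continuous fun t : ℝ => x + t • θ := by fun_prop
  have hx' : x ∉ frontier Ω := by
    rw [hΩ.frontier_eq]; exact fun h => h.2 hx
  have heq : hitTimes Ω x θ = Ici 0 ∩ (fun t : ℝ => x + t • θ) ⁻¹' frontier Ω := by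
    ext t
    constructor
    · exact fun ht => ⟨ht.1.le, ht.2⟩
    · rintro ⟨h0, h1⟩
      refine ⟨lt_of_le_of_ne h0 ?_, h1⟩
      rintro rfl
      exact hx' (by simpa using h1)
  have hcl : IsClosed (hitTimes Ω x θ) := by
    rw [heq]; exact isClosed_Ici.inter (isClosed_frontier.preimage hc)
  have hb : BddBelow (hitTimes Ω x θ) := ⟨0, fun t ht => ht.1.le⟩
  have hmem := hcl.csInf_mem h hb
  refine ⟨hmem.1, hmem.2, fun t ht => ?_⟩
  by_contra hn
  have hpre : IsPreconnected ((fun t : ℝ => x + t • θ) '' Icc 0 t) :=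
    isPreconnected_Icc.image _ hc.continuousOn
  have hfr : ∃ s ∈ Icc 0 t, x + s • θ ∈ frontier Ω := by
    by_contra! hno
    obtain ⟨y, -, hy1, hy2⟩ := hpre Ω (closure Ω)ᶜ hΩ isClosed_closure.isOpen_compl
      (by
        rintro _ ⟨s, hs, rfl⟩
        have h1 := hno s hs
        rw [hΩ.frontier_eq] at h1
        by_cases h2 : x + s • θ ∈ Ω
        · exact Or.inl h2
        · exact Or.inr fun h3 => h1 ⟨h3, h2⟩)
      ⟨x, ⟨0, ⟨le_rfl, ht.1.le⟩, by simp⟩, hx⟩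
      ⟨_, ⟨t, ⟨ht.1.le, le_rfl⟩, rfl⟩, fun h3 => hno t ⟨ht.1.le, le_rfl⟩ (by
        rw [hΩ.frontier_eq]; exact ⟨h3, hn⟩)⟩
    exact hy2 (subset_closure hy1)
  obtain ⟨s, hs, hy⟩ := hfr
  have hs' : s ∈ hitTimes Ω x θ := by rw [heq]; exact ⟨hs.1, hy⟩
  exact absurd (csInf_le hb hs') (not_le.2 (lt_of_le_of_lt hs.2 ht.2))

/-!
The component of `u` in the direction `θ` has derivative `⟪θ ⊗ θ, ℰu⟫` along a ray of direction `θ`,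
so on the segment from `x` to `ζ(x, θ)` it changes by at most the integral of `|ℰu|`. The average
over `θ` of `|⟪θ, u x⟫|` is comparable to `|u x|`, and polar coordinates turn the average of the ray
integrals into `∫ |ℰu y| / |x - y| ^ (n - 1)`.

Since `ℰu` is only a function defined almost everywhere, the argument is run for a mollification of
`u` at scale `ε`, along the ray from the distance `ε` on: there the kernel `|x - ·| ^ (1 - n)` is at
most `2 ^ (n - 1)` times its mollification. Fatou's lemma then gives the limit `ε → 0`.
-/

open Filter Metric Topology
open Module (finrank)
open scoped Convolution InnerProductSpace

section LConvolution

variable {G : Type*} [AddGroup G] [MeasurableSpace G] [MeasurableAdd₂ G] [MeasurableNeg G]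
  {μ : Measure G} [SFinite μ] {f k : G → ℝ≥0∞}

theorem measurable_lconvolution_of_aemeasurable (hf : AEMeasurable f μ) (hk : Measurable k) :
    Measurable (f ⋆ₗ[μ] k) := by
  have h : f ⋆ₗ[μ] k = hf.mk f ⋆ₗ[μ] k := funext fun _ =>
    lintegral_congr_ae (hf.ae_eq_mk.mono fun _ hz => by simp only [hz])
  exact h ▸ measurable_lconvolution μ hf.measurable_mk hk

theorem lintegral_lconvolution [μ.IsAddLeftInvariant] (hf : AEMeasurable f μ) (hk : Measurable k) :
    ∫⁻ y, (f ⋆ₗ[μ] k) y ∂μ = (∫⁻ y, f y ∂μ) * ∫⁻ y, k y ∂μ := by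
  calc ∫⁻ y, (f ⋆ₗ[μ] k) y ∂μ
      = ∫⁻ z, ∫⁻ y, f z * k (-z + y) ∂μ ∂μ := by
        refine lintegral_lintegral_swap (AEMeasurable.mul hf.comp_snd ?_)
        exact (hk.comp (measurable_snd.neg.add measurable_fst)).aemeasurable
    _ = ∫⁻ z, f z * ∫⁻ y, k y ∂μ ∂μ := by
        refine lintegral_congr fun z => ?_
        rw [lintegral_const_mul _ (by fun_prop), lintegral_add_left_eq_self]
    _ = _ := lintegral_mul_const'' _ hf

end LConvolution

theorem lconvolution_add_div_enorm_pow_le {E : Type*} [NormedAddCommGroup E] [MeasurableSpace E]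
    (μ : Measure E) {f k : E → ℝ≥0∞} {ε : ℝ} (hk : Function.support k ⊆ closedBall 0 ε) (d : ℕ)
    (x : E) {y : E} (hy : ε ≤ ‖y‖) :
    (f ⋆ₗ[μ] k) (x + y) / ‖y‖ₑ ^ d
      ≤ ((fun z => 2 ^ d * (f z / ‖x - z‖ₑ ^ d)) ⋆ₗ[μ] k) (x + y) := by
  rw [lconvolution_def, lconvolution_def, div_eq_mul_inv]
  refine (lintegral_mul_const_le _ _).trans (lintegral_mono fun z => ?_)
  rcases eq_or_ne (k (-z + (x + y))) 0 with h0 | h0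
  · simp [h0]
  have hle : ‖x - z‖ ≤ 2 * ‖y‖ := by
    have hmem : ‖-z + (x + y)‖ ≤ ε := by simpa using hk h0
    have htri : ‖x - z‖ ≤ ‖-z + (x + y)‖ + ‖y‖ := by
      simpa [show -z + (x + y) - y = x - z by abel] using norm_sub_le (-z + (x + y)) y
    linarith
  have hle' : ‖x - z‖ₑ ≤ 2 * ‖y‖ₑ := by
    rw [← ofReal_norm, ← ofReal_norm, ← ENNReal.ofReal_ofNat 2, ← ENNReal.ofReal_mul (by simp)]
    exact ENNReal.ofReal_le_ofReal hle
  have hinv : (‖y‖ₑ ^ d)⁻¹ ≤ 2 ^ d * (‖x - z‖ₑ ^ d)⁻¹ := by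
    rw [← div_eq_mul_inv, ENNReal.le_div_iff_mul_le (by simp) (by simp), mul_comm]
    calc ‖x - z‖ₑ ^ d * (‖y‖ₑ ^ d)⁻¹ ≤ (2 * ‖y‖ₑ) ^ d * (‖y‖ₑ ^ d)⁻¹ := by gcongr
      _ = 2 ^ d * (‖y‖ₑ ^ d * (‖y‖ₑ ^ d)⁻¹) := by rw [mul_pow, mul_assoc]
      _ ≤ 2 ^ d := mul_le_of_le_one_right' (ENNReal.mul_inv_le_one _)
  calc f z * k (-z + (x + y)) * (‖y‖ₑ ^ d)⁻¹
      ≤ f z * k (-z + (x + y)) * (2 ^ d * (‖x - z‖ₑ ^ d)⁻¹) := by gcongr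
    _ = 2 ^ d * (f z / ‖x - z‖ₑ ^ d) * k (-z + (x + y)) := by rw [div_eq_mul_inv]; ring

section Polar

variable {E : Type*} [NormedAddCommGroup E] [NormedSpace ℝ E] [FiniteDimensional ℝ E]
  [MeasurableSpace E] [BorelSpace E] (μ : Measure E) [μ.IsAddHaarMeasure] {f k : E → ℝ≥0∞}

theorem lintegral_volumeIoiPow_eq (d : ℕ) {φ : Ioi (0 : ℝ) → ℝ≥0∞} (hφ : Measurable φ) :
    ∫⁻ t, φ t ∂Measure.volumeIoiPow d
      = ∫⁻ t : Ioi (0 : ℝ), ENNReal.ofReal (t : ℝ) ^ d * φ t ∂volume.comap Subtype.val := by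
  rw [Measure.volumeIoiPow, lintegral_withDensity_eq_lintegral_mul _ (by fun_prop) hφ]
  exact lintegral_congr fun t => by rw [Pi.mul_apply, ENNReal.ofReal_pow t.2.out.le]

theorem lintegral_eq_lintegral_toSphere_prod [Nontrivial E] (f : E → ℝ≥0∞) :
    ∫⁻ y, f y ∂μ = ∫⁻ p : sphere (0 : E) 1 × Ioi (0 : ℝ), f ((p.2 : ℝ) • (p.1 : E))
      ∂μ.toSphere.prod (Measure.volumeIoiPow (finrank ℝ E - 1)) := by
  calc ∫⁻ y, f y ∂μ = ∫⁻ y : ({0}ᶜ : Set E), f y ∂μ.comap (↑) := by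
        rw [lintegral_subtype_comap (measurableSet_singleton _).compl, restrict_compl_singleton]
    _ = ∫⁻ y : ({0}ᶜ : Set E), f (((homeomorphUnitSphereProd E y).2 : ℝ) •
          ((homeomorphUnitSphereProd E y).1 : E)) ∂μ.comap (↑) := by
        simp_rw [← homeomorphUnitSphereProd_symm_apply_coe, Homeomorph.symm_apply_apply]
    _ = _ := μ.measurePreserving_homeomorphUnitSphereProd.lintegral_comp_emb
        (Homeomorph.measurableEmbedding _) fun p => f ((p.2 : ℝ) • (p.1 : E))

theorem lintegral_toSphere_lintegral_Ioi_zero [Nontrivial E] (hf : Measurable f) :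
    ∫⁻ θ : sphere (0 : E) 1, (∫⁻ t in Ioi (0 : ℝ), f (t • (θ : E))) ∂μ.toSphere
      = ∫⁻ y, f y / ‖y‖ₑ ^ (finrank ℝ E - 1) ∂μ := by
  set d := finrank ℝ E - 1
  rw [lintegral_eq_lintegral_toSphere_prod μ fun y => f y / ‖y‖ₑ ^ d,
    lintegral_prod _ (by fun_prop)]
  refine lintegral_congr fun θ => ?_
  rw [lintegral_volumeIoiPow_eq _ (by fun_prop), ← lintegral_subtype_comap measurableSet_Ioi]
  refine lintegral_congr fun t => ?_
  have ht : (0 : ℝ) < t := t.2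
  have hnorm : ‖(t : ℝ) • (θ : E)‖ₑ = ENNReal.ofReal t := by
    rw [← ofReal_norm, norm_smul, norm_eq_of_mem_sphere, mul_one, Real.norm_of_nonneg ht.le]
  rw [hnorm, ENNReal.mul_div_cancel (pow_ne_zero _ (ENNReal.ofReal_pos.2 ht).ne') (by simp)]

theorem lintegral_toSphere_lintegral_Ioi [Nontrivial E] (hf : Measurable f) {r : ℝ} (hr : 0 ≤ r) :
    ∫⁻ θ : sphere (0 : E) 1, (∫⁻ t in Ioi r, f (t • (θ : E))) ∂μ.toSphere
      = ∫⁻ y in {y | r < ‖y‖}, f y / ‖y‖ₑ ^ (finrank ℝ E - 1) ∂μ := by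
  have hS : MeasurableSet {y : E | r < ‖y‖} := measurableSet_lt measurable_const measurable_norm
  have hray : ∀ θ : sphere (0 : E) 1, ∫⁻ t in Ioi r, f (t • (θ : E))
      = ∫⁻ t in Ioi (0 : ℝ), {y : E | r < ‖y‖}.indicator f (t • (θ : E)) := fun θ => by
    rw [← inter_eq_self_of_subset_left (Ioi_subset_Ioi hr),
      ← setLIntegral_indicator measurableSet_Ioi]
    refine setLIntegral_congr_fun measurableSet_Ioi fun t ht => ?_
    have hnorm : ‖t • (θ : E)‖ = t := by
      rw [norm_smul, norm_eq_of_mem_sphere, mul_one, Real.norm_of_nonneg (le_of_lt ht)]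
    simp [indicator, hnorm]
  simp_rw [hray]
  rw [lintegral_toSphere_lintegral_Ioi_zero μ (hf.indicator hS), ← lintegral_indicator hS]
  refine lintegral_congr fun y => ?_
  by_cases hy : r < ‖y‖ <;> simp [indicator, hy]

theorem lintegral_toSphere_lintegral_lconvolution_le [Nontrivial E] (hf : AEMeasurable f μ)
    (hk : Measurable k) {ε : ℝ} (hε : 0 ≤ ε) (hsupp : Function.support k ⊆ closedBall 0 ε) (x : E) :
    ∫⁻ θ : sphere (0 : E) 1, (∫⁻ t in Ioi ε, (f ⋆ₗ[μ] k) (x + t • (θ : E))) ∂μ.toSphere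
      ≤ 2 ^ (finrank ℝ E - 1) * (∫⁻ z, f z / ‖x - z‖ₑ ^ (finrank ℝ E - 1) ∂μ) * ∫⁻ y, k y ∂μ := by
  set d := finrank ℝ E - 1
  have hF : AEMeasurable (fun z => f z / ‖x - z‖ₑ ^ d) μ := by fun_prop
  calc ∫⁻ θ : sphere (0 : E) 1, (∫⁻ t in Ioi ε, (f ⋆ₗ[μ] k) (x + t • (θ : E))) ∂μ.toSphere
      = ∫⁻ y in {y | ε < ‖y‖}, (f ⋆ₗ[μ] k) (x + y) / ‖y‖ₑ ^ d ∂μ :=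
        lintegral_toSphere_lintegral_Ioi μ
          ((measurable_lconvolution_of_aemeasurable hf hk).comp (measurable_const_add x)) hε
    _ ≤ ∫⁻ y in {y | ε < ‖y‖}, ((fun z => 2 ^ d * (f z / ‖x - z‖ₑ ^ d)) ⋆ₗ[μ] k) (x + y) ∂μ :=
        setLIntegral_mono' (measurableSet_lt measurable_const measurable_norm) fun y hy =>
          lconvolution_add_div_enorm_pow_le μ hsupp d x (le_of_lt hy)
    _ ≤ ∫⁻ y, ((fun z => 2 ^ d * (f z / ‖x - z‖ₑ ^ d)) ⋆ₗ[μ] k) (x + y) ∂μ :=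
        setLIntegral_le_lintegral _ _
    _ = 2 ^ d * (∫⁻ z, f z / ‖x - z‖ₑ ^ d ∂μ) * ∫⁻ y, k y ∂μ := by
        rw [lintegral_add_left_eq_self, lintegral_lconvolution (hF.const_mul _) hk,
          lintegral_const_mul'' _ hF]

end Polar

section HausdorffMeasure

variable {E : Type*} [NormedAddCommGroup E] [NormedSpace ℝ E]

theorem ofReal_le_lintegral_Ioi_indicator_closedBall {r : ℝ} {θ θ₀ : E} (hθ : ‖θ‖ = 1)
    (hr : θ ∈ closedBall θ₀ r) :
    ENNReal.ofReal r ≤ ∫⁻ t in Ioi (1 : ℝ), (closedBall θ₀ (2 * r)).indicator 1 (t • θ) := by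
  calc ENNReal.ofReal r = ∫⁻ _ in Ioc (1 : ℝ) (1 + r), 1 := by simp
    _ ≤ ∫⁻ t in Ioc (1 : ℝ) (1 + r), (closedBall θ₀ (2 * r)).indicator 1 (t • θ) := by
      refine setLIntegral_mono' measurableSet_Ioc fun t ht => ?_
      have hdist : dist (t • θ) θ = t - 1 := by
        rw [dist_eq_norm, show t • θ - θ = (t - 1) • θ by rw [sub_smul, one_smul], norm_smul, hθ,
          mul_one, Real.norm_of_nonneg (sub_nonneg.2 ht.1.le)]
      have hmem : t • θ ∈ closedBall θ₀ (2 * r) := by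
        calc dist (t • θ) θ₀ ≤ dist (t • θ) θ + dist θ θ₀ := dist_triangle _ _ _
          _ ≤ 2 * r := by linarith [ht.2, mem_closedBall.1 hr]
      rw [indicator_of_mem hmem, Pi.one_apply]
    _ ≤ _ := lintegral_mono_set Ioc_subset_Ioi_self

variable [FiniteDimensional ℝ E] [Nontrivial E] [MeasurableSpace E] [BorelSpace E] (μ : Measure E)
  [μ.IsAddHaarMeasure]

theorem toSphere_le_of_subset_closedBall {s : Set (sphere (0 : E) 1)} {θ₀ : E} {r : ℝ} (hr : 0 < r)
    (hs : ∀ θ ∈ s, (θ : E) ∈ closedBall θ₀ r) :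
    μ.toSphere s
      ≤ 2 ^ finrank ℝ E * μ (ball 0 1) * ENNReal.ofReal r ^ (finrank ℝ E - 1) := by
  set d := finrank ℝ E
  set b := (closedBall θ₀ (2 * r)).indicator (1 : E → ℝ≥0∞)
  have hb : Measurable b := measurable_one.indicator isClosed_closedBall.measurableSet
  have hr0 : ENNReal.ofReal r ≠ 0 := (ENNReal.ofReal_pos.2 hr).ne'
  -- The rays with directions in `s` spend at least the length `r` in a common ball of radius
  -- `2 * r`, outside the unit ball: compare with its volume in polar coordinates.
  have hle : ENNReal.ofReal r * μ.toSphere s ≤ μ (closedBall θ₀ (2 * r)) := by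
    calc ENNReal.ofReal r * μ.toSphere s
        ≤ ENNReal.ofReal r * μ.toSphere {θ | ENNReal.ofReal r
            ≤ ∫⁻ t in Ioi (1 : ℝ), b (t • (θ : E))} := by
          gcongr
          exact fun θ hθ => ofReal_le_lintegral_Ioi_indicator_closedBall
            (norm_eq_of_mem_sphere θ) (hs θ hθ)
      _ ≤ ∫⁻ θ : sphere (0 : E) 1, (∫⁻ t in Ioi (1 : ℝ), b (t • (θ : E))) ∂μ.toSphere :=
          mul_meas_ge_le_lintegral
            (Measurable.lintegral_prod_right' (f := fun p : sphere (0 : E) 1 × ℝ =>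
              b (p.2 • (p.1 : E))) (by fun_prop)) _
      _ = ∫⁻ y in {y | 1 < ‖y‖}, b y / ‖y‖ₑ ^ (d - 1) ∂μ :=
          lintegral_toSphere_lintegral_Ioi μ hb zero_le_one
      _ ≤ ∫⁻ y in {y | 1 < ‖y‖}, b y ∂μ := by
          refine setLIntegral_mono' (measurableSet_lt measurable_const measurable_norm)
            fun y (hy : 1 < ‖y‖) => ENNReal.div_le_of_le_mul' (le_mul_of_one_le_left' ?_)
          exact one_le_pow₀ (by simpa [← ofReal_norm] using hy.le)
      _ ≤ ∫⁻ y, b y ∂μ := setLIntegral_le_lintegral _ _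
      _ = μ (closedBall θ₀ (2 * r)) := lintegral_indicator_one isClosed_closedBall.measurableSet
  have hd : ENNReal.ofReal r ^ d = ENNReal.ofReal r * ENNReal.ofReal r ^ (d - 1) :=
    (mul_pow_sub_one Module.finrank_pos.ne' _).symm
  refine (ENNReal.mul_le_mul_iff_right hr0 ENNReal.ofReal_ne_top).1 (hle.trans_eq ?_)
  rw [μ.addHaar_closedBall _ (by positivity), ENNReal.ofReal_pow (by positivity),
    ENNReal.ofReal_mul zero_le_two, ENNReal.ofReal_ofNat, mul_pow, hd]
  ring

theorem toSphere_le_ediam_pow (s : Set (sphere (0 : E) 1)) :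
    μ.toSphere s ≤ 2 ^ finrank ℝ E * μ (ball 0 1) * ediam s ^ (finrank ℝ E - 1) := by
  rcases s.eq_empty_or_nonempty with rfl | ⟨θ₀, hθ₀⟩
  · simp
  have hbdd : Bornology.IsBounded s := isBounded_of_compactSpace
  have hlim : Tendsto (fun r => 2 ^ finrank ℝ E * μ (ball 0 1) *
      ENNReal.ofReal r ^ (finrank ℝ E - 1)) (𝓝[>] diam s)
      (𝓝 (2 ^ finrank ℝ E * μ (ball 0 1) * ENNReal.ofReal (diam s) ^ (finrank ℝ E - 1))) := by
    refine tendsto_nhdsWithin_of_tendsto_nhds (Continuous.tendsto ?_ _)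
    exact (ENNReal.continuous_const_mul
      (ENNReal.mul_ne_top (by simp) measure_ball_lt_top.ne)).comp
        ((ENNReal.continuous_pow _).comp ENNReal.continuous_ofReal)
  rw [← ENNReal.ofReal_toReal hbdd.ediam_ne_top]
  refine ge_of_tendsto hlim (eventually_mem_nhdsWithin.mono fun r (hr : diam s < r) => ?_)
  exact toSphere_le_of_subset_closedBall μ (diam_nonneg.trans_lt hr) fun θ hθ =>
    ((dist_le_diam_of_mem hbdd hθ hθ₀).trans hr.le : dist θ θ₀ ≤ r)

theorem toSphere_le_smul_hausdorffMeasure :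
    μ.toSphere ≤ (2 ^ finrank ℝ E * μ (ball 0 1)) • μH[(finrank ℝ E : ℝ) - 1] := by
  set c := 2 ^ finrank ℝ E * μ (ball (0 : E) 1)
  have hc0 : c ≠ 0 := mul_ne_zero (by simp) (measure_ball_pos μ 0 one_pos).ne'
  have hc : c ≠ ⊤ := ENNReal.mul_ne_top (by simp) measure_ball_lt_top.ne
  have hle : c⁻¹ • μ.toSphere ≤ μH[(finrank ℝ E : ℝ) - 1] := by
    refine Measure.le_hausdorffMeasure _ _ 1 one_pos fun s _ => ?_
    rw [← Nat.cast_pred Module.finrank_pos, ENNReal.rpow_natCast, Measure.smul_apply, smul_eq_mul,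
      ENNReal.inv_mul_le_iff hc0 hc]
    exact toSphere_le_ediam_pow μ s
  calc μ.toSphere = c • c⁻¹ • μ.toSphere := by
        rw [smul_smul, ENNReal.mul_inv_cancel hc0 hc, one_smul]
    _ ≤ c • μH[(finrank ℝ E : ℝ) - 1] := by gcongr

theorem lintegral_toSphere_le_setLIntegral_hausdorffMeasure (f : E → ℝ≥0∞) :
    ∫⁻ θ : sphere (0 : E) 1, f θ ∂μ.toSphere
      ≤ 2 ^ finrank ℝ E * μ (ball 0 1) *
        ∫⁻ θ in sphere (0 : E) 1, f θ ∂μH[(finrank ℝ E : ℝ) - 1] := by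
  have hdim : (0 : ℝ) ≤ (finrank ℝ E : ℝ) - 1 :=
    sub_nonneg.2 (Nat.one_le_cast.2 (Nat.succ_le_of_lt Module.finrank_pos))
  have hmap := (isometry_subtype_coe (s := sphere (0 : E) 1)).map_hausdorffMeasure (Or.inl hdim)
  rw [Subtype.range_coe] at hmap
  rw [← hmap, (MeasurableEmbedding.subtype_coe isClosed_sphere.measurableSet).lintegral_map,
    ← smul_eq_mul, ← lintegral_smul_measure]
  exact lintegral_mono' (toSphere_le_smul_hausdorffMeasure μ) le_rfl

end HausdorffMeasure

theorem exists_enorm_le_mul_lintegral_enorm_inner {E : Type*} [NormedAddCommGroup E]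
    [InnerProductSpace ℝ E] [FiniteDimensional ℝ E] [MeasurableSpace E] [BorelSpace E]
    (ν : Measure (sphere (0 : E) 1)) [IsFiniteMeasure ν] [ν.IsOpenPosMeasure] :
    ∃ K : ℝ≥0, 0 < K ∧ ∀ v : E, ‖v‖ₑ ≤ K * ∫⁻ θ : sphere (0 : E) 1, ‖⟪(θ : E), v⟫_ℝ‖ₑ ∂ν := by
  let component : E →ₗ[ℝ] C(sphere (0 : E) 1, ℝ) :=
    { toFun := fun v => ⟨fun θ => ⟪(θ : E), v⟫_ℝ, by fun_prop⟩
      map_add' := fun v w => by ext θ; exact inner_add_right _ v w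
      map_smul' := fun c v => by ext θ; exact real_inner_smul_right _ v c }
  let T : E →ₗ[ℝ] Lp ℝ 1 ν := (ContinuousMap.toLp 1 ν ℝ).toLinearMap ∘ₗ component
  have hT : T.ker = ⊥ := by
    refine LinearMap.ker_eq_bot'.2 fun v hv => by_contra fun hv0 => ?_
    have hcomp : component v = 0 := ContinuousMap.toLp_injective (𝕜 := ℝ) (p := 1) ν
      (by simpa [T] using hv)
    have hself : ⟪‖v‖⁻¹ • v, v⟫_ℝ = 0 :=
      DFunLike.congr_fun hcomp ⟨‖v‖⁻¹ • v, by simp [norm_smul, hv0]⟩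
    simp [real_inner_smul_left, hv0] at hself
  have hnorm : ∀ v, ‖T v‖ₑ = ∫⁻ θ : sphere (0 : E) 1, ‖⟪(θ : E), v⟫_ℝ‖ₑ ∂ν := fun v => by
    rw [Lp.enorm_def, eLpNorm_one_eq_lintegral_enorm]
    exact lintegral_congr_ae ((ContinuousMap.coeFn_toLp (𝕜 := ℝ) ν (component v)).mono
      fun θ hθ => congrArg _ hθ)
  obtain ⟨K, hK, hTK⟩ := T.exists_antilipschitzWith hT
  exact ⟨K, hK, fun v => by simpa [hnorm] using hTK v 0⟩

section WeakSymGradient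

/-- The dyad `θ ⊗ θ`, as an element of the space of matrices with the Frobenius norm. -/
noncomputable def dyad {ι : Type*} (θ : EuclideanSpace ℝ ι) : EuclideanSpace ℝ (ι × ι) :=
  WithLp.toLp 2 fun p => θ p.1 * θ p.2

theorem norm_dyad {ι : Type*} [Fintype ι] (θ : EuclideanSpace ℝ ι) : ‖dyad θ‖ = ‖θ‖ ^ 2 := by
  rw [EuclideanSpace.real_norm_sq_eq, EuclideanSpace.norm_eq, Real.sqrt_eq_iff_eq_sq
    (by positivity) (by positivity), sq (∑ i, _), Finset.sum_mul_sum, Fintype.sum_prod_type]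
  simp only [dyad, Real.norm_eq_abs, sq_abs, mul_pow]

theorem inner_mul_apply_eq_sum_dyad {ι : Type*} [Fintype ι] [DecidableEq ι]
    (θ v : EuclideanSpace ℝ ι) (L : EuclideanSpace ℝ ι →ₗ[ℝ] ℝ) :
    ⟪θ, v⟫_ℝ * L θ = ∑ p, dyad θ p * ((v p.1 * L (EuclideanSpace.single p.2 1)
      + v p.2 * L (EuclideanSpace.single p.1 1)) / 2) := by
  have hinner : ⟪θ, v⟫_ℝ = ∑ i, θ i * v i := by simp [PiLp.inner_apply, mul_comm]
  have hL : L θ = ∑ j, θ j * L (EuclideanSpace.single j 1) := by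
    conv_lhs => rw [← (EuclideanSpace.basisFun ι ℝ).sum_repr θ]
    simp
  have hleft : ⟪θ, v⟫_ℝ * L θ
      = ∑ p : ι × ι, dyad θ p * (v p.1 * L (EuclideanSpace.single p.2 1)) := by
    rw [hinner, hL, Finset.sum_mul_sum, Fintype.sum_prod_type]
    exact Finset.sum_congr rfl fun i _ => Finset.sum_congr rfl fun j _ => by
      simp only [dyad]; ring
  have hright : ⟪θ, v⟫_ℝ * L θ
      = ∑ p : ι × ι, dyad θ p * (v p.2 * L (EuclideanSpace.single p.1 1)) := by
    rw [hleft, ← (Equiv.prodComm ι ι).sum_comp]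
    exact Finset.sum_congr rfl fun p _ => by simp [dyad, mul_comm (θ p.1)]
  calc ⟪θ, v⟫_ℝ * L θ = (⟪θ, v⟫_ℝ * L θ + ⟪θ, v⟫_ℝ * L θ) / 2 := by ring
    _ = _ := by
      nth_rewrite 1 [hleft]
      rw [hright, ← Finset.sum_add_distrib, Finset.sum_div]
      exact Finset.sum_congr rfl fun p _ => by ring

theorem integrableOn_mul_of_tsupport_subset {X : Type*}
    [TopologicalSpace X] [T2Space X] [MeasurableSpace X] [OpensMeasurableSpace X]
    [SecondCountableTopology X] {μ : Measure X}
    {Ω : Set X} {f φ : X → ℝ} (hf : LocallyIntegrableOn f Ω μ) (hφ : Continuous φ)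
    (hc : HasCompactSupport φ) (hs : tsupport φ ⊆ Ω) :
    IntegrableOn (fun y => f y * φ y) Ω μ := by
  have h2 : IntegrableOn (fun y => f y * φ y) (tsupport φ) μ :=
    (hf.integrableOn_compact_subset hs hc).mul_continuousOn hφ.continuousOn hc
  refine (h2.integrable_of_forall_notMem_eq_zero fun y hy => ?_).integrableOn
  rw [image_eq_zero_of_notMem_tsupport hy, mul_zero]

theorem locallyIntegrableOn_apply {X ι : Type*} [TopologicalSpace X] [MeasurableSpace X] [Fintype ι]
    {μ : Measure X} {s : Set X} {f : X → EuclideanSpace ℝ ι} (hf : LocallyIntegrableOn f s μ)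
    (i : ι) : LocallyIntegrableOn (fun y => f y i) s μ := fun y hy => by
  obtain ⟨t, ht, hft⟩ := hf y hy
  exact ⟨t, ht, (EuclideanSpace.proj (𝕜 := ℝ) i).integrable_comp hft⟩

variable {n : ℕ} {Ω : Set (EuclideanSpace ℝ (Fin n))}
  {u : EuclideanSpace ℝ (Fin n) → EuclideanSpace ℝ (Fin n)}
  {G : EuclideanSpace ℝ (Fin n) → EuclideanSpace ℝ (Fin n × Fin n)}

theorem HasWeakSymGradient.integral_inner_mul_fderiv
    (h : HasWeakSymGradient Ω u G) {φ : EuclideanSpace ℝ (Fin n) → ℝ}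
    (hφ : ContDiff ℝ ∞ φ) (hc : HasCompactSupport φ) (hs : tsupport φ ⊆ Ω)
    (θ : EuclideanSpace ℝ (Fin n)) :
    ∫ y in Ω, ⟪θ, u y⟫_ℝ * fderiv ℝ φ y θ = -∫ y in Ω, ⟪dyad θ, G y⟫_ℝ * φ y := by
  obtain ⟨hu, hG, hweak⟩ := h
  have hudφ : ∀ i j, IntegrableOn
      (fun y => u y i * fderiv ℝ φ y (EuclideanSpace.single j 1)) Ω := fun i j =>
    integrableOn_mul_of_tsupport_subset (locallyIntegrableOn_apply hu i)
      ((hφ.continuous_fderiv (by simp)).clm_apply continuous_const)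
      (hc.fderiv_apply (𝕜 := ℝ) _)
      ((tsupport_fderiv_apply_subset ℝ _).trans hs)
  have hGφ : ∀ p, IntegrableOn (fun y => G y p * φ y) Ω := fun p =>
    integrableOn_mul_of_tsupport_subset (locallyIntegrableOn_apply hG p) hφ.continuous hc hs
  have hdyad : ∀ y, ⟪dyad θ, G y⟫_ℝ * φ y = ∑ p, dyad θ p * (G y p * φ y) := fun y => by
    rw [PiLp.inner_apply, Finset.sum_mul]
    exact Finset.sum_congr rfl fun p _ => by simp; ring
  have hinner : ∀ y, ⟪θ, u y⟫_ℝ * fderiv ℝ φ y θ = _ := fun y =>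
    inner_mul_apply_eq_sum_dyad θ (u y) (fderiv ℝ φ y).toLinearMap
  simp_rw [hdyad, hinner]
  rw [integral_finsetSum _ fun p _ => (hGφ p).const_mul _, integral_finsetSum _ fun p _ =>
    (((hudφ p.1 p.2).add (hudφ p.2 p.1)).div_const 2).const_mul _, ← Finset.sum_neg_distrib]
  refine Finset.sum_congr rfl fun p _ => ?_
  rw [integral_const_mul, integral_const_mul, ← mul_neg]
  exact congrArg _ (hweak p.1 p.2 φ hφ hc hs)

end WeakSymGradient

section Mollification

section Kernel

variable {E : Type*} [NormedAddCommGroup E] [NormedSpace ℝ E] [FiniteDimensional ℝ E]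
  [MeasurableSpace E] [BorelSpace E] {μ : Measure E}

theorem lintegral_enorm_normed [HasContDiffBump E] [IsLocallyFiniteMeasure μ]
    [μ.IsOpenPosMeasure] {c : E} (ρ : ContDiffBump c) :
    ∫⁻ y, ‖ρ.normed μ y‖ₑ ∂μ = 1 := by
  rw [← ofReal_integral_norm_eq_lintegral_enorm ρ.integrable_normed]
  simp_rw [Real.norm_of_nonneg (ρ.nonneg_normed _)]
  rw [ρ.integral_normed, ENNReal.ofReal_one]

theorem tsupport_normed_sub_subset [HasContDiffBump E] [IsLocallyFiniteMeasure μ]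
    [μ.IsOpenPosMeasure] (ρ : ContDiffBump (0 : E)) (y : E) :
    tsupport (fun z => ρ.normed μ (y - z)) ⊆ closedBall y ρ.rOut := by
  refine closure_minimal (fun z hz => ?_) isClosed_closedBall
  have hz' : y - z ∈ ball (0 : E) ρ.rOut := ρ.support_normed_eq (μ := μ) ▸ hz
  rw [mem_closedBall_iff_norm']
  exact (mem_ball_zero_iff.1 hz').le

theorem fderiv_convolution_apply_eq_neg_integral [μ.IsAddHaarMeasure] {w r : E → ℝ}
    (hw : LocallyIntegrable w μ) (hr : ContDiff ℝ 1 r) (hrc : HasCompactSupport r) (y θ : E) :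
    fderiv ℝ (w ⋆[ContinuousLinearMap.lsmul ℝ ℝ, μ] r) y θ
      = -∫ z, w z * fderiv ℝ (fun z => r (y - z)) z θ ∂μ := by
  have hreflect : ∀ z, fderiv ℝ (fun z => r (y - z)) z θ = -fderiv ℝ r (y - z) θ := fun z => by
    have hcomp : HasFDerivAt (fun z => r (y - z)) _ z :=
      ((hr.differentiable one_ne_zero) (y - z)).hasFDerivAt.comp z ((hasFDerivAt_id z).const_sub y)
    simp [hcomp.fderiv]
  rw [(hrc.hasFDerivAt_convolution_right (ContinuousLinearMap.lsmul ℝ ℝ) hw hr y).fderiv,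
    convolution_precompR_apply _ hw (hrc.fderiv ℝ) (hr.continuous_fderiv one_ne_zero),
    convolution_lsmul, ← integral_neg]
  exact integral_congr_ae (Eventually.of_forall fun z => by simp [hreflect])

theorem tendsto_convolution_normed [HasContDiffBump E] [μ.IsAddHaarMeasure] {w : E → ℝ}
    (hw : AEStronglyMeasurable w μ) {z : E} (hwz : ContinuousAt w z)
    {ρ : ℕ → ContDiffBump (0 : E)} (hρ : Tendsto (fun k => (ρ k).rOut) atTop (𝓝 0))
    {p : ℕ → E} (hp : Tendsto p atTop (𝓝 z)) :
    Tendsto (fun k => (w ⋆[ContinuousLinearMap.lsmul ℝ ℝ, μ] (ρ k).normed μ) (p k)) atTop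
      (𝓝 (w z)) := by
  have hright := ContDiffBump.convolution_tendsto_right (μ := μ) (g := fun _ : ℕ => w) hρ
    (Eventually.of_forall fun _ => hw) (hwz.tendsto.comp tendsto_snd) hp
  refine hright.congr fun k => ?_
  rw [convolution_lsmul_swap, convolution_lsmul]
  simp only [smul_eq_mul, mul_comm]

end Kernel

theorem enorm_sub_le_lintegral_fderiv_ray {E F : Type*} [NormedAddCommGroup E] [NormedSpace ℝ E]
    [NormedAddCommGroup F] [NormedSpace ℝ F] {H : E → F} (hH : ContDiff ℝ 1 H) (x θ : E) {a b : ℝ}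
    (hab : a ≤ b) :
    ‖H (x + b • θ) - H (x + a • θ)‖ₑ ≤ ∫⁻ t in Ioc a b, ‖fderiv ℝ H (x + t • θ) θ‖ₑ := by
  have hderiv : ∀ t : ℝ, HasDerivAt (fun t : ℝ => H (x + t • θ)) (fderiv ℝ H (x + t • θ) θ) t :=
    fun t => by
      have hline : HasDerivAt (fun t : ℝ => x + t • θ) θ t := by
        simpa using ((hasDerivAt_id t).smul_const θ).const_add x
      exact ((hH.differentiable one_ne_zero) _).hasFDerivAt.comp_hasDerivAt t hline
  have hftc := enorm_sub_le_lintegral_deriv_of_contDiffOn_Icc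
    (f := fun t : ℝ => H (x + t • θ)) (hH.comp (by fun_prop)).contDiffOn hab
  simpa only [(hderiv _).deriv, restrict_Ioc_eq_restrict_Icc] using hftc

theorem exists_forall_closedBall_subset_of_isCompact {X : Type*} [PseudoMetricSpace X] {K Ω : Set X}
    (hK : IsCompact K) (hΩ : IsOpen Ω) (hKΩ : K ⊆ Ω) :
    ∃ δ > 0, ∀ y ∈ K, closedBall y δ ⊆ Ω := by
  obtain ⟨δ, hδ, hδΩ⟩ := hK.exists_cthickening_subset_open hΩ hKΩ
  exact ⟨δ, hδ, fun y hy => (closedBall_subset_cthickening hy δ).trans hδΩ⟩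

/-- The integral of a mollified density `f` along the ray issued from `x` in the direction `θ`.
It starts at the distance `ρ.rOut` from `x`, so that `‖z - x‖ ≤ 2 * ‖y - x‖` whenever `y` is on this
part of the ray and `y - z` is in the support of the mollifier. -/
noncomputable def mollifiedRayIntegral {E : Type*} [NormedAddCommGroup E] [NormedSpace ℝ E]
    [HasContDiffBump E] [MeasurableSpace E] (μ : Measure E) (ρ : ContDiffBump (0 : E))
    (f : E → ℝ≥0∞) (x θ : E) : ℝ≥0∞ :=
  ∫⁻ t in Ioi ρ.rOut, (f ⋆ₗ[μ] fun y => ‖ρ.normed μ y‖ₑ) (x + t • θ)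

section MollifiedRayIntegral

variable {E : Type*} [NormedAddCommGroup E] [NormedSpace ℝ E] [FiniteDimensional ℝ E]
  [HasContDiffBump E] [MeasurableSpace E] [BorelSpace E] (μ : Measure E) [μ.IsAddHaarMeasure]
  (ρ : ContDiffBump (0 : E)) {f : E → ℝ≥0∞}

theorem measurable_lconvolution_enorm_normed (hf : AEMeasurable f μ) :
    Measurable (f ⋆ₗ[μ] fun y => ‖ρ.normed μ y‖ₑ) :=
  measurable_lconvolution_of_aemeasurable hf ρ.continuous_normed.enorm.measurable

theorem measurable_mollifiedRayIntegral (hf : AEMeasurable f μ) (x : E) :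
    Measurable (mollifiedRayIntegral μ ρ f x) := by
  have hconv := measurable_lconvolution_enorm_normed μ ρ hf
  exact Measurable.lintegral_prod_right' (f := fun p : E × ℝ =>
    (f ⋆ₗ[μ] fun y => ‖ρ.normed μ y‖ₑ) (x + p.2 • p.1)) (by fun_prop)

theorem lintegral_toSphere_mollifiedRayIntegral_le [Nontrivial E] (hf : AEMeasurable f μ) (x : E) :
    ∫⁻ θ : sphere (0 : E) 1, mollifiedRayIntegral μ ρ f x θ ∂μ.toSphere
      ≤ 2 ^ (finrank ℝ E - 1) * ∫⁻ z, f z / ‖x - z‖ₑ ^ (finrank ℝ E - 1) ∂μ := by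
  have hsupp : Function.support (fun y => ‖ρ.normed μ y‖ₑ) ⊆ closedBall 0 ρ.rOut := by
    intro y hy
    rw [← ρ.tsupport_normed_eq (μ := μ)]
    exact subset_closure (by simpa using hy)
  simpa only [mollifiedRayIntegral, lintegral_enorm_normed, mul_one] using
    lintegral_toSphere_lintegral_lconvolution_le μ hf ρ.continuous_normed.enorm.measurable
      ρ.rOut_pos.le hsupp x

end MollifiedRayIntegral

end Mollification

section Rays

variable {n : ℕ} {Ω : Set (EuclideanSpace ℝ (Fin n))} {x θ : EuclideanSpace ℝ (Fin n)}
  {u : EuclideanSpace ℝ (Fin n) → EuclideanSpace ℝ (Fin n)}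
  {G : EuclideanSpace ℝ (Fin n) → EuclideanSpace ℝ (Fin n × Fin n)}

/-- The component of the field `u` in the direction `θ`, extended by zero outside `Ω` so that it
can be mollified in the whole space. -/
noncomputable def extendedComponent (Ω : Set (EuclideanSpace ℝ (Fin n)))
    (u : EuclideanSpace ℝ (Fin n) → EuclideanSpace ℝ (Fin n)) (θ : EuclideanSpace ℝ (Fin n)) :
    EuclideanSpace ℝ (Fin n) → ℝ :=
  Ω.indicator fun z => ⟪θ, u z⟫_ℝ

theorem locallyIntegrable_extendedComponent (hΩ : IsOpen Ω) (hu : ContinuousOn u (closure Ω))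
    (θ : EuclideanSpace ℝ (Fin n)) : LocallyIntegrable (extendedComponent Ω u θ) := by
  refine locallyIntegrable_iff.2 fun K hK => ?_
  have hcompact : IntegrableOn (fun z => ⟪θ, u z⟫_ℝ) (closure Ω ∩ K) :=
    (continuousOn_const.inner (hu.mono inter_subset_left)).integrableOn_compact
      (hK.inter_left isClosed_closure)
  rw [extendedComponent, IntegrableOn, integrable_indicator_iff hΩ.measurableSet, IntegrableOn,
    Measure.restrict_restrict hΩ.measurableSet]
  exact hcompact.mono_set (inter_subset_inter_left _ subset_closure)

theorem continuousAt_extendedComponent (hΩ : IsOpen Ω) (hu : ContinuousOn u Ω) (hx : x ∈ Ω) :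
    ContinuousAt (extendedComponent Ω u θ) x := by
  have hinner : ContinuousAt (fun z => ⟪θ, u z⟫_ℝ) x :=
    continuousAt_const.inner (hu.continuousAt (hΩ.mem_nhds hx))
  exact hinner.congr (eqOn_indicator.symm.eventuallyEq_of_mem (hΩ.mem_nhds hx))

theorem HasWeakSymGradient.fderiv_convolution_extendedComponent (h : HasWeakSymGradient Ω u G)
    (hΩ : IsOpen Ω) (hu : LocallyIntegrable (extendedComponent Ω u θ))
    (ρ : ContDiffBump (0 : EuclideanSpace ℝ (Fin n))) {y : EuclideanSpace ℝ (Fin n)}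
    (hy : closedBall y ρ.rOut ⊆ Ω) :
    fderiv ℝ (extendedComponent Ω u θ ⋆[ContinuousLinearMap.lsmul ℝ ℝ] ρ.normed volume) y θ
      = ∫ z in Ω, ⟪dyad θ, G z⟫_ℝ * ρ.normed volume (y - z) := by
  have hsupp := tsupport_normed_sub_subset (μ := volume) ρ y
  have hφ : ContDiff ℝ ∞ fun z => ρ.normed volume (y - z) :=
    ρ.contDiff_normed.comp (contDiff_const.sub contDiff_id)
  rw [fderiv_convolution_apply_eq_neg_integral hu ρ.contDiff_normed ρ.hasCompactSupport_normed,
    neg_eq_iff_eq_neg, ← h.integral_inner_mul_fderiv hφ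
      ((isCompact_closedBall y ρ.rOut).of_isClosed_subset (isClosed_tsupport _) hsupp)
      (hsupp.trans hy), ← integral_indicator hΩ.measurableSet]
  simp only [extendedComponent, indicator_mul_left]

theorem HasWeakSymGradient.enorm_fderiv_convolution_le (h : HasWeakSymGradient Ω u G)
    (hΩ : IsOpen Ω) (hu : LocallyIntegrable (extendedComponent Ω u θ)) (hθ : ‖θ‖ = 1)
    (ρ : ContDiffBump (0 : EuclideanSpace ℝ (Fin n))) {y : EuclideanSpace ℝ (Fin n)}
    (hy : closedBall y ρ.rOut ⊆ Ω) :
    ‖fderiv ℝ (extendedComponent Ω u θ ⋆[ContinuousLinearMap.lsmul ℝ ℝ] ρ.normed volume) y θ‖ₑ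
      ≤ ((Ω.indicator fun z => ‖G z‖ₑ) ⋆ₗ fun z => ‖ρ.normed volume z‖ₑ) y := by
  have hdyad : ∀ z, ‖⟪dyad θ, G z⟫_ℝ‖ₑ ≤ ‖G z‖ₑ := fun z => by
    rw [enorm_le_iff_norm_le]
    simpa [norm_dyad, hθ] using norm_inner_le_norm (𝕜 := ℝ) (dyad θ) (G z)
  rw [h.fderiv_convolution_extendedComponent hΩ hu ρ hy, lconvolution_def]
  calc ‖∫ z in Ω, ⟪dyad θ, G z⟫_ℝ * ρ.normed volume (y - z)‖ₑ
      ≤ ∫⁻ z in Ω, ‖⟪dyad θ, G z⟫_ℝ * ρ.normed volume (y - z)‖ₑ :=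
        enorm_integral_le_lintegral_enorm _
    _ ≤ ∫⁻ z in Ω, ‖G z‖ₑ * ‖ρ.normed volume (-z + y)‖ₑ := by
        refine lintegral_mono fun z => ?_
        rw [enorm_mul, ← sub_eq_neg_add]
        gcongr
        exact hdyad z
    _ = ∫⁻ z, Ω.indicator (fun z => ‖G z‖ₑ) z * ‖ρ.normed volume (-z + y)‖ₑ := by
        rw [← lintegral_indicator hΩ.measurableSet]
        simp only [indicator_mul_left]

theorem HasWeakSymGradient.enorm_convolution_sub_le (h : HasWeakSymGradient Ω u G)
    (hΩ : IsOpen Ω) (hu : LocallyIntegrable (extendedComponent Ω u θ)) (hθ : ‖θ‖ = 1)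
    (ρ : ContDiffBump (0 : EuclideanSpace ℝ (Fin n))) {s : ℝ} (hs : ρ.rOut ≤ s)
    (hball : ∀ t ∈ Icc ρ.rOut s, closedBall (x + t • θ) ρ.rOut ⊆ Ω) :
    ‖(extendedComponent Ω u θ ⋆[ContinuousLinearMap.lsmul ℝ ℝ] ρ.normed volume) (x + s • θ)
        - (extendedComponent Ω u θ ⋆[ContinuousLinearMap.lsmul ℝ ℝ] ρ.normed volume)
          (x + ρ.rOut • θ)‖ₑ
      ≤ mollifiedRayIntegral volume ρ (Ω.indicator fun z => ‖G z‖ₑ) x θ := by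
  have hsmooth : ContDiff ℝ 1
      (extendedComponent Ω u θ ⋆[ContinuousLinearMap.lsmul ℝ ℝ] ρ.normed volume) :=
    ρ.hasCompactSupport_normed.contDiff_convolution_right _ hu ρ.contDiff_normed
  refine (enorm_sub_le_lintegral_fderiv_ray hsmooth x θ hs).trans ?_
  refine (setLIntegral_mono' measurableSet_Ioc fun t ht => ?_).trans
    (lintegral_mono_set Ioc_subset_Ioi_self)
  exact h.enorm_fderiv_convolution_le hΩ hu hθ ρ (hball t (Ioc_subset_Icc_self ht))

theorem HasWeakSymGradient.enorm_inner_sub_le_liminf (h : HasWeakSymGradient Ω u G)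
    (hΩ : IsOpen Ω) (hu : ContinuousOn u (closure Ω)) (hθ : ‖θ‖ = 1)
    {ρ : ℕ → ContDiffBump (0 : EuclideanSpace ℝ (Fin n))}
    (hρ : Tendsto (fun k => (ρ k).rOut) atTop (𝓝 0)) {s : ℝ} (hs : 0 < s)
    (hseg : ∀ t ∈ Icc 0 s, x + t • θ ∈ Ω) :
    ‖⟪θ, u (x + s • θ)⟫_ℝ - ⟪θ, u x⟫_ℝ‖ₑ ≤ liminf (fun k =>
      mollifiedRayIntegral volume (ρ k) (Ω.indicator fun z => ‖G z‖ₑ) x θ) atTop := by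
  have hint := locallyIntegrable_extendedComponent hΩ hu θ
  have hlim : ∀ {p : ℕ → EuclideanSpace ℝ (Fin n)} {z}, z ∈ Ω → Tendsto p atTop (𝓝 z) →
      Tendsto (fun k => (extendedComponent Ω u θ ⋆[ContinuousLinearMap.lsmul ℝ ℝ]
        (ρ k).normed volume) (p k)) atTop (𝓝 ⟪θ, u z⟫_ℝ) := fun {p z} hz hp => by
    simpa only [extendedComponent, indicator_of_mem hz] using
      tendsto_convolution_normed hint.aestronglyMeasurable
        (continuousAt_extendedComponent hΩ (hu.mono subset_closure) hz) hρ hp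
  have hstart : Tendsto (fun k => x + (ρ k).rOut • θ) atTop (𝓝 x) := by
    simpa using (hρ.smul_const θ).const_add x
  have hx : x ∈ Ω := by simpa using hseg 0 ⟨le_rfl, hs.le⟩
  obtain ⟨δ, hδ, hδΩ⟩ := exists_forall_closedBall_subset_of_isCompact
    (isCompact_Icc.image (by fun_prop : Continuous fun t : ℝ => x + t • θ)) hΩ
    (image_subset_iff.2 hseg)
  rw [← (((hlim (hseg s ⟨hs.le, le_rfl⟩) tendsto_const_nhds).sub
    (hlim hx hstart)).enorm).liminf_eq]
  refine liminf_le_liminf ?_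
  filter_upwards [hρ.eventually_lt_const hδ, hρ.eventually_lt_const hs] with k hkδ hks
  refine h.enorm_convolution_sub_le hΩ hint hθ (ρ k) hks.le fun t ht => ?_
  exact (closedBall_subset_closedBall hkδ.le).trans
    (hδΩ _ (mem_image_of_mem _ ⟨(ρ k).rOut_pos.le.trans ht.1, ht.2⟩))

theorem add_smul_mem_of_hitTimes_eq_empty (hΩ : IsOpen Ω) (hx : x ∈ Ω)
    (h : hitTimes Ω x θ = ∅) {t : ℝ} (ht : 0 ≤ t) : x + t • θ ∈ Ω := by
  have hray : (fun t : ℝ => x + t • θ) '' Ici 0 ⊆ Ω := by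
    refine (isPreconnected_Ici.image _ (by fun_prop)).subset_of_closure_inter_subset hΩ
      ⟨x, ⟨0, self_mem_Ici, by simp⟩, hx⟩ ?_
    rintro _ ⟨hcl, t, ht, rfl⟩
    by_contra hnot
    rcases (mem_Ici.1 ht).eq_or_lt with rfl | hpos
    · exact hnot (by simpa using hx)
    · exact h.subset ⟨hpos, hΩ.frontier_eq ▸ ⟨hcl, hnot⟩⟩
  exact hray ⟨t, ht, rfl⟩

theorem MemCb.boundaryValue_mem_closure (hu : MemCb Ω u) (hΩ : IsOpen Ω) (hx : x ∈ Ω)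
    (hθ : θ ≠ 0) :
    boundaryValue Ω u x θ ∈
      closure ((fun s : ℝ => u (x + s • θ)) '' {s | 0 < s ∧ ∀ t ∈ Icc 0 s, x + t • θ ∈ Ω}) := by
  rcases (hitTimes Ω x θ).eq_empty_or_nonempty with hempty | hne
  · have hin : ∀ t : ℝ, 0 ≤ t → x + t • θ ∈ Ω := fun t =>
      add_smul_mem_of_hitTimes_eq_empty hΩ hx hempty
    rw [boundaryValue, if_neg (not_nonempty_iff_eq_empty.2 hempty)]
    obtain ⟨R, hR⟩ := hu.2.subset_closedBall x
    obtain ⟨s, hsR, hs⟩ := ((eventually_gt_atTop (R / ‖θ‖)).and (eventually_gt_atTop 0)).exists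
    refine subset_closure ⟨s, ⟨hs, fun t ht => hin t ht.1⟩, ?_⟩
    by_contra hsupp
    have hle := mem_closedBall_iff_norm.1 (hR ⟨subset_closure (hin s hs.le), hsupp⟩)
    rw [add_sub_cancel_left, norm_smul, Real.norm_of_nonneg hs.le] at hle
    exact hle.not_gt ((div_lt_iff₀ (norm_pos_iff.2 hθ)).1 hsR)
  · obtain ⟨hpos, hfr, hin⟩ := firstHit_spec hΩ hx hne
    rw [boundaryValue, if_pos hne]
    have hray : Tendsto (fun s : ℝ => x + s • θ) (𝓝[<] sInf (hitTimes Ω x θ))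
        (𝓝[closure Ω] firstHit Ω x θ) := by
      refine tendsto_nhdsWithin_iff.2 ⟨?_, ?_⟩
      · exact ((by fun_prop : Continuous fun s : ℝ => x + s • θ).tendsto _).mono_left
          nhdsWithin_le_nhds
      · filter_upwards [Ioo_mem_nhdsLT hpos] with s hs using subset_closure (hin s hs)
    refine mem_closure_of_tendsto
      ((hu.1 _ (frontier_subset_closure hfr)).tendsto.comp hray) ?_
    filter_upwards [Ioo_mem_nhdsLT hpos] with s hs
    refine ⟨s, ⟨hs.1, fun t ht => ?_⟩, rfl⟩
    rcases ht.1.eq_or_lt with rfl | h0t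
    · simpa using hx
    · exact hin t ⟨h0t, ht.2.trans_lt hs.2⟩

theorem HasWeakSymGradient.enorm_inner_le_boundaryValue_add (h : HasWeakSymGradient Ω u G)
    (hΩ : IsOpen Ω) (hu : MemCb Ω u) (hθ : ‖θ‖ = 1)
    {ρ : ℕ → ContDiffBump (0 : EuclideanSpace ℝ (Fin n))}
    (hρ : Tendsto (fun k => (ρ k).rOut) atTop (𝓝 0)) (hx : x ∈ Ω) :
    ‖⟪θ, u x⟫_ℝ‖ₑ ≤ ‖boundaryValue Ω u x θ‖ₑ + liminf (fun k =>
      mollifiedRayIntegral volume (ρ k) (Ω.indicator fun z => ‖G z‖ₑ) x θ) atTop := by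
  have hinner : ∀ v, ‖⟪θ, v⟫_ℝ‖ₑ ≤ ‖v‖ₑ := fun v => by
    rw [enorm_le_iff_norm_le]
    simpa [hθ] using norm_inner_le_norm (𝕜 := ℝ) θ v
  refine closure_minimal (t := {v | ‖⟪θ, u x⟫_ℝ‖ₑ ≤ ‖v‖ₑ + _}) ?_
    (isClosed_le continuous_const (by fun_prop))
    (hu.boundaryValue_mem_closure hΩ hx (norm_ne_zero_iff.1 (hθ.trans_ne one_ne_zero)))
  rintro _ ⟨s, ⟨hs, hseg⟩, rfl⟩
  calc ‖⟪θ, u x⟫_ℝ‖ₑ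
      = ‖⟪θ, u (x + s • θ)⟫_ℝ - (⟪θ, u (x + s • θ)⟫_ℝ - ⟪θ, u x⟫_ℝ)‖ₑ := by rw [sub_sub_cancel]
    _ ≤ _ := enorm_sub_le.trans
      (add_le_add (hinner _) (h.enorm_inner_sub_le_liminf hΩ hu.1 hθ hρ hs hseg))

end Rays

theorem exists_contDiffBump_seq_tendsto_rOut {E : Type*} [NormedAddCommGroup E]
    [NormedSpace ℝ E] [HasContDiffBump E] (c : E) :
    ∃ ρ : ℕ → ContDiffBump c, Tendsto (fun k => (ρ k).rOut) atTop (𝓝 0) :=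
  ⟨fun k => ⟨1 / ((k : ℝ) + 1) / 2, 1 / ((k : ℝ) + 1), by positivity,
    half_lt_self (by positivity)⟩, tendsto_one_div_add_atTop_nhds_zero_nat⟩

theorem HasWeakSymGradient.lintegral_toSphere_enorm_inner_le {n : ℕ} [NeZero n]
    {Ω : Set (EuclideanSpace ℝ (Fin n))}
    {u : EuclideanSpace ℝ (Fin n) → EuclideanSpace ℝ (Fin n)}
    {G : EuclideanSpace ℝ (Fin n) → EuclideanSpace ℝ (Fin n × Fin n)}
    (h : HasWeakSymGradient Ω u G) (hΩ : IsOpen Ω) (hu : MemCb Ω u)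
    {x : EuclideanSpace ℝ (Fin n)} (hx : x ∈ Ω) :
    ∫⁻ θ : sphere (0 : EuclideanSpace ℝ (Fin n)) 1,
        ‖⟪(θ : EuclideanSpace ℝ (Fin n)), u x⟫_ℝ‖ₑ ∂volume.toSphere
      ≤ ∫⁻ θ : sphere (0 : EuclideanSpace ℝ (Fin n)) 1,
          ‖boundaryValue Ω u x θ‖ₑ ∂volume.toSphere
        + 2 ^ (n - 1) * ∫⁻ y in Ω, ‖G y‖ₑ / ‖x - y‖ₑ ^ (n - 1) := by
  obtain ⟨ρ, hρ⟩ := exists_contDiffBump_seq_tendsto_rOut (0 : EuclideanSpace ℝ (Fin n))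
  have hG : AEMeasurable (Ω.indicator fun z => ‖G z‖ₑ) :=
    (aemeasurable_indicator_iff hΩ.measurableSet).2 h.2.1.aestronglyMeasurable.enorm
  have hmeas : ∀ k, Measurable fun θ : sphere (0 : EuclideanSpace ℝ (Fin n)) 1 =>
      mollifiedRayIntegral volume (ρ k) (Ω.indicator fun z => ‖G z‖ₑ) x θ := fun k =>
    (measurable_mollifiedRayIntegral volume (ρ k) hG x).comp measurable_subtype_coe
  have hle : ∀ k, ∫⁻ θ : sphere (0 : EuclideanSpace ℝ (Fin n)) 1,
      mollifiedRayIntegral volume (ρ k) (Ω.indicator fun z => ‖G z‖ₑ) x θ ∂volume.toSphere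
        ≤ 2 ^ (n - 1) * ∫⁻ y in Ω, ‖G y‖ₑ / ‖x - y‖ₑ ^ (n - 1) := fun k => by
    simpa only [finrank_euclideanSpace_fin, ← lintegral_indicator hΩ.measurableSet, div_eq_mul_inv,
      indicator_mul_left] using lintegral_toSphere_mollifiedRayIntegral_le volume (ρ k) hG x
  refine (lintegral_mono fun θ => h.enorm_inner_le_boundaryValue_add hΩ hu
    (norm_eq_of_mem_sphere θ) hρ hx).trans ?_
  rw [lintegral_add_right _ (Measurable.liminf hmeas)]
  gcongr
  exact (lintegral_liminf_le hmeas).trans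
    (liminf_le_of_frequently_le' (Frequently.of_forall hle))

theorem theorem2p1_general (n : ℕ) (hn : 1 ≤ n) :
    ∃ C : ℝ≥0, 0 < C ∧
      ∀ Ω : Set (EuclideanSpace ℝ (Fin n)), IsOpen Ω →
      ∀ u : EuclideanSpace ℝ (Fin n) → EuclideanSpace ℝ (Fin n), MemCb Ω u →
      ∀ G : EuclideanSpace ℝ (Fin n) → EuclideanSpace ℝ (Fin n × Fin n),
        HasWeakSymGradient Ω u G →
      ∀ x ∈ Ω,
        ‖u x‖ₑ ≤
          C * (∫⁻ θ in sphere (0 : EuclideanSpace ℝ (Fin n)) 1,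
                ‖boundaryValue Ω u x θ‖ₑ ∂(Measure.hausdorffMeasure ((n : ℝ) - 1)))
            + C * ∫⁻ y in Ω, ‖G y‖ₑ / ‖x - y‖ₑ ^ (n - 1) := by
  have : NeZero n := ⟨by omega⟩
  obtain ⟨K, hK, hKle⟩ := exists_enorm_le_mul_lintegral_enorm_inner
    (volume : Measure (EuclideanSpace ℝ (Fin n))).toSphere
  set A := (2 ^ n * volume (ball (0 : EuclideanSpace ℝ (Fin n)) 1)).toNNReal
  have hA : (A : ℝ≥0∞) = 2 ^ n * volume (ball (0 : EuclideanSpace ℝ (Fin n)) 1) :=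
    ENNReal.coe_toNNReal (by finiteness)
  refine ⟨K * (A + 2 ^ (n - 1)), by positivity, fun Ω hΩ u hu G hG x hx => ?_⟩
  have hbdry := lintegral_toSphere_le_setLIntegral_hausdorffMeasure
    (volume : Measure (EuclideanSpace ℝ (Fin n))) fun θ => ‖boundaryValue Ω u x θ‖ₑ
  rw [finrank_euclideanSpace_fin, ← hA] at hbdry
  set D := ∫⁻ θ in sphere (0 : EuclideanSpace ℝ (Fin n)) 1, ‖boundaryValue Ω u x θ‖ₑ
    ∂(Measure.hausdorffMeasure ((n : ℝ) - 1))
  set I := ∫⁻ y in Ω, ‖G y‖ₑ / ‖x - y‖ₑ ^ (n - 1)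
  calc ‖u x‖ₑ ≤ K * (A * D + 2 ^ (n - 1) * I) := (hKle (u x)).trans <| by
        gcongr
        exact (hG.lintegral_toSphere_enorm_inner_le hΩ hu hx).trans (by gcongr)
    _ ≤ K * ((A + 2 ^ (n - 1)) * D + (A + 2 ^ (n - 1)) * I) := by
        gcongr
        exacts [le_self_add, le_add_self]
    _ = (K * (A + 2 ^ (n - 1)) : ℝ≥0) * D + (K * (A + 2 ^ (n - 1)) : ℝ≥0) * I := by
        push_cast
        ring

theorem theorem2p1 (n : ℕ) (hn : 2 ≤ n) :
    ∃ C : ℝ≥0, 0 < C ∧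
      ∀ Ω : Set (EuclideanSpace ℝ (Fin n)), IsOpen Ω →
      ∀ u : EuclideanSpace ℝ (Fin n) → EuclideanSpace ℝ (Fin n),
        MemE 1 Ω u → MemCb Ω u →
      ∀ G : EuclideanSpace ℝ (Fin n) → EuclideanSpace ℝ (Fin n × Fin n),
        HasWeakSymGradient Ω u G →
      ∀ x ∈ Ω,
        ‖u x‖ₑ ≤
          C * (∫⁻ θ in Metric.sphere (0 : EuclideanSpace ℝ (Fin n)) 1,
                ‖boundaryValue Ω u x θ‖ₑ ∂(Measure.hausdorffMeasure ((n : ℝ) - 1)))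
            + C * ∫⁻ y in Ω, ‖G y‖ₑ / ‖x - y‖ₑ ^ (n - 1) := by
  obtain ⟨C, hC, hle⟩ := theorem2p1_general n (one_le_two.trans hn)
  exact ⟨C, hC, fun Ω hΩ u _ hu => hle Ω hΩ u hu⟩
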